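/- Conventions. Let $D$ be a finite set. A weighted relation of arity $n$ on $D$ is a function $\rho:R\to\mathbb{Q}_{\ge 0}$ with $R\subseteq D^n$; a weighted structure $wA$ on $D$ is a finite list $\rho_1,\dots,\rho_t$ of weighted relations $\rho_i:R_i\to\mathbb{Q}_{\ge0}$ on $D$. A polymorphism of $wA$ is an operation on $D$ that, applied component-wise, preserves every $R_i$; $wA$ is a rigid core if its only unary polymorphism is the identity. A $k$-ary weighted polymorphism of $wA$ is a function $\omega:C\to\mathbb{Q}$ on a set $C$ of $k$-ary polymorphisms of $wA$ such that (i) $\sum_{f\in C}\omega(f)=0$; (ii) if $\omega(f)<0$ then $f$ is a projection; (iii) $\sum_{f\in C}\omega(f)\,\rho_i(f(x_1,\dots,x_k))\le 0$ for all $i$ and all $x_1,\dots,x_k\in R_i$. The pair $(\mathcal{D},u)$ is built from $wA$ as follows. Let $R=R_1\times\dots\times R_t\subseteq D^n$, where $n$ is the sum of the arities, and $\rho(a_1,\dots,a_t)=\sum_i\rho_i(a_i)$. Start with the vertex set $D\cup R$ (disjoint union) and edge set $D\times R$, and replace each edge $(d,r)$ by the oriented path $$\bullet\to\bullet\ \dotplus\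 Q_1\ \dotplus\cdots\dotplus\ Q_n\ \dotplus\ \bullet\to\bullet$$ from $d$ to $r$, where $Q_l$ is a single edge $\bullet\to\bullet$ if $d=r_l$ and the zigzag $\bullet\to\bullet\leftarrow\bullet\to\bullet$ otherwise; this is the digraph $\mathcal{D}$. Put $u(r)=\rho(r)$ for $r\in R$ and $u(v)=0$ for every other vertex $v$. A weighted polymorphism of $(\mathcal{D},u)$ is one of the weighted structure on the vertex set of $\mathcal{D}$ that consists of the edge relation of $\mathcal{D}$ with all weights $0$ and of the unary weighted relation $u$. An identity $t_1=t_2$ between terms over $k$-ary operation symbols is linear if each of $t_1,t_2$ contains at most one occurrence of an operation symbol, and balanced if $t_1$ and $t_2$ contain the same variables. For $k\ge2$, a $k$-ary operation $f$ is WNU if $f(x,\dots,x)=x$ and $f(y,x,\dots,x)=f(x,y,x,\dots,x)=\dots=f(x,\dots,x,y)$, cyclic if $f(x_1,\dots,x_k)=f(x_2,\dots,x_k,x_1)$, and symmetric if it is invariant under all permutations of its arguments. **Theorem.** Let $wA$ be a weighted structure on a finite set $D$ that is a rigid core, let $k\ge1$, and let $\omega:C\to\mathbb{Q}$ be a $k$-ary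 weighted polymorphism of $wA$. Let $\Sigma$ be a set of linear balanced identities in $k$-ary symbols $f_\lambda$ $(\lambda\in\Lambda)$, and let each $f_\lambda$ be interpreted by an operation $f_\lambda^{A}\in C$ with $\omega(f_\lambda^{A})\ge 0$ (for instance, by any non-projection in $C$), so that the operations $f_\lambda^{A}$ satisfy $\Sigma$. Then $(\mathcal{D},u)$ has a $k$-ary weighted polymorphism $\omega_0:C_0\to\mathbb{Q}$ and there is a bijection $\varphi:C\to C_0$ with $\omega_0(\varphi(f))=\omega(f)$ for all $f\in C$, such that the operations $\varphi(f_\lambda^{A})$ satisfy $\Sigma$. Moreover, if $f\in C$ is WNU (respectively cyclic, symmetric), then so is $\varphi(f)$. If in addition every projection in $C$ has non-positive weight and interprets no symbol $f_\lambda$, then $\varphi$ and $\omega_0$ also have this property: if all non-projection operations in $C$ are WNU (respectively cyclic, symmetric), then so are all non-projection operations in $C_0$. -/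

import Mathlib

namespace WeightedHom

universe u v w

/-- `k`-ary operations on `A`. -/
abbrev Op (k : ℕ) (A : Type u) : Type u := (Fin k → A) → A

/-- A weighted relation of arity `n` on `A`: a relation together with non-negative rational
weights on its tuples. -/
structure WeightedRelation (n : ℕ) (A : Type u) where
  rel : Set (Fin n → A)
  wt : rel → ℚ≥0

/-- A weighted structure with domain `A`: finitely many weighted relations on `A`. -/
structure WeightedStructure (A : Type u) where
  numRel : ℕ
  arity : Fin numRel → ℕ
  wrel : (i : Fin numRel) → WeightedRelation (arity i) A

/-- Component-wise application of a `k`-ary operation to `k` tuples. -/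
def applyTuple {A : Type u} {k n : ℕ} (f : Op k A) (x : Fin k → Fin n → A) : Fin n → A :=
  fun j => f (fun i => x i j)

/-- `f` is a polymorphism of the relation `R`. -/
def Preserves {A : Type u} {k n : ℕ} (f : Op k A) (R : Set (Fin n → A)) : Prop :=
  ∀ x : Fin k → Fin n → A, (∀ i, x i ∈ R) → applyTuple f x ∈ R

/-- `f` is a polymorphism of (each relation of) the structure `S`. -/
def IsPolymorphism {A : Type u} {k : ℕ} (S : WeightedStructure A) (f : Op k A) : Prop :=
  ∀ i, Preserves f (S.wrel i).rel

/-- The only unary polymorphism is the identity. -/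
def IsRigidCore {A : Type u} (S : WeightedStructure A) : Prop :=
  ∀ f : Op 1 A, IsPolymorphism S f → ∀ x, f x = x 0

def IsProjection {A : Type u} {k : ℕ} (f : Op k A) : Prop :=
  ∃ i, ∀ x, f x = x i

/-- `ω : C → ℚ` is a `k`-ary weighted polymorphism of every weighted relation of `S`. The
conditions that do not mention the relation are stated once. -/
structure IsWeightedPolymorphism {A : Type u} {k : ℕ} (S : WeightedStructure A)
    (C : Finset (Op k A)) (ω : C → ℚ) : Prop where
  pol : ∀ f : C, IsPolymorphism S f.1
  sum_eq_zero : ∑ f : C, ω f = 0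
  proj_of_neg : ∀ f : C, ω f < 0 → IsProjection f.1
  sum_le_zero : ∀ (i : Fin S.numRel) (x : Fin k → Fin (S.arity i) → A)
    (hx : ∀ j, x j ∈ (S.wrel i).rel),
    ∑ f : C, ω f * ((S.wrel i).wt ⟨applyTuple f.1 x, pol f i x hx⟩ : ℚ) ≤ 0

/-- The direct product of all weighted relations of `S`: tuples are concatenations of tuples of
the individual relations, and weights are added. -/
def WeightedStructure.product {A : Type u} (S : WeightedStructure A) :
    WeightedRelation (∑ i, S.arity i) A where
  rel := {r | ∀ i, (fun j => r (finSigmaFinEquiv ⟨i, j⟩)) ∈ (S.wrel i).rel}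
  wt := fun r => ∑ i, (S.wrel i).wt ⟨fun j => r.1 (finSigmaFinEquiv ⟨i, j⟩), r.2 i⟩

/-- Vertices of the digraph obtained from the edges `D × R` on `D ∪ R` by replacing each edge
`(d, r)` by the oriented path `• → • ∔ Q₁ ∔ ⋯ ∔ Qₙ ∔ • → •`, where `Qₗ` is a single edge if
`d = rₗ` and the zigzag `• → • ← • → •` otherwise. On the path of `(d, r)`, `joint d r 0` is the
end of the first edge, and `Qₗ` (`l = 0, …, n - 1`) goes from `joint d r l` to
`joint d r (l + 1)`; if `Qₗ` is a zigzag, its two inner vertices are, in this order, `hi` and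
`lo`. -/
inductive Vertex {D : Type u} {n : ℕ} (R : Set (Fin n → D)) : Type u
  | base (d : D) : Vertex R
  | top (r : R) : Vertex R
  | joint (d : D) (r : R) (m : Fin (n + 1)) : Vertex R
  | hi (d : D) (r : R) (l : Fin n) (h : d ≠ r.1 l) : Vertex R
  | lo (d : D) (r : R) (l : Fin n) (h : d ≠ r.1 l) : Vertex R

/-- The edges of the digraph. -/
inductive Edge {D : Type u} {n : ℕ} (R : Set (Fin n → D)) : Vertex R → Vertex R → Prop
  | first (d : D) (r : R) : Edge R (.base d) (.joint d r 0)
  | last (d : D) (r : R) : Edge R (.joint d r (Fin.last n)) (.top r)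
  | single (d : D) (r : R) (l : Fin n) (h : d = r.1 l) :
      Edge R (.joint d r l.castSucc) (.joint d r l.succ)
  | zig₁ (d : D) (r : R) (l : Fin n) (h : d ≠ r.1 l) :
      Edge R (.joint d r l.castSucc) (.hi d r l h)
  | zig₂ (d : D) (r : R) (l : Fin n) (h : d ≠ r.1 l) :
      Edge R (.lo d r l h) (.hi d r l h)
  | zig₃ (d : D) (r : R) (l : Fin n) (h : d ≠ r.1 l) :
      Edge R (.lo d r l h) (.joint d r l.succ)

/-- The unary cost function: the weight of `r` on the vertex `r ∈ R`, and `0` elsewhere. -/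
def vertexCost {D : Type u} {n : ℕ} (ρ : WeightedRelation n D) : Vertex ρ.rel → ℚ≥0
  | .top r => ρ.wt r
  | _ => 0

/-- A digraph with a finite-valued unary cost function, as a weighted structure: the binary edge
relation with all weights `0`, and the full unary relation with weights given by the cost. -/
def digraphStructure {V : Type u} (E : V → V → Prop) (c : V → ℚ≥0) : WeightedStructure V where
  numRel := 2
  arity := fun i => match i with
    | 0 => 2
    | 1 => 1
  wrel := fun i => match i with
    | 0 => { rel := {x | E (x 0) (x 1)}, wt := fun _ => 0 }
    | 1 => { rel := Set.univ, wt := fun x => c (x.1 0) }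

/-- The vertex set of the digraph built from `S`. -/
abbrev WeightedStructure.DVertex {D : Type u} (S : WeightedStructure D) : Type u :=
  Vertex S.product.rel

/-- The digraph with unary cost function built from `S`. -/
def WeightedStructure.toDigraph {D : Type u} (S : WeightedStructure D) :
    WeightedStructure S.DVertex :=
  digraphStructure (Edge S.product.rel) (vertexCost S.product)

/-- Terms with variables from `X` over a set `L` of `k`-ary operation symbols. -/
inductive OpTerm (L : Type v) (k : ℕ) (X : Type w) : Type (max v w)
  | var (x : X) : OpTerm L k X
  | app (s : L) (args : Fin k → OpTerm L k X) : OpTerm L k X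

namespace OpTerm

variable {L : Type v} {k : ℕ} {X : Type w}

/-- Number of occurrences of operation symbols. -/
def opCount : OpTerm L k X → ℕ
  | var _ => 0
  | app _ args => 1 + ∑ i, (args i).opCount

/-- The variables occurring in a term. -/
def vars : OpTerm L k X → Set X
  | var x => {x}
  | app _ args => ⋃ i, (args i).vars

/-- Value of a term when symbols are interpreted by `I` and variables by `a`. -/
def eval {A : Type u} (I : L → Op k A) (a : X → A) : OpTerm L k X → A
  | var x => a x
  | app s args => I s (fun i => (args i).eval I a)

end OpTerm

/-- An identity `lhs = rhs`. -/
structure Identity (L : Type v) (k : ℕ) (X : Type w) where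
  lhs : OpTerm L k X
  rhs : OpTerm L k X

def Identity.IsLinear {L : Type v} {k : ℕ} {X : Type w} (e : Identity L k X) : Prop :=
  e.lhs.opCount ≤ 1 ∧ e.rhs.opCount ≤ 1

def Identity.IsBalanced {L : Type v} {k : ℕ} {X : Type w} (e : Identity L k X) : Prop :=
  e.lhs.vars = e.rhs.vars

/-- The operations `I s` satisfy all identities of the set. -/
def Satisfies {L : Type v} {k : ℕ} {X : Type w} {A : Type u} (I : L → Op k A)
    (Sigma : Set (Identity L k X)) : Prop :=
  ∀ e ∈ Sigma, ∀ a : X → A, e.lhs.eval I a = e.rhs.eval I a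

/-- Weak near unanimity operations (idempotent, of arity at least two). -/
def IsWNU {A : Type u} {k : ℕ} (f : Op k A) : Prop :=
  2 ≤ k ∧ (∀ x : A, f (fun _ => x) = x) ∧
    ∀ (x y : A) (i j : Fin k),
      f (Function.update (fun _ => x) i y) = f (Function.update (fun _ => x) j y)

def IsCyclic {A : Type u} {k : ℕ} (f : Op k A) : Prop :=
  2 ≤ k ∧ ∀ x : Fin k → A, f x = f (fun i => x (finRotate k i))

def IsSymmetric {A : Type u} {k : ℕ} (f : Op k A) : Prop :=
  2 ≤ k ∧ ∀ (x : Fin k → A) (π : Equiv.Perm (Fin k)), f x = f (fun i => x (π i))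

end WeightedHom

/-! Each polymorphism `f` in `C` is lifted to the vertices of the digraph. On vertices of `D` the
lift is `f`, and on vertices of `R` it is `f` applied component-wise. A tuple of inner vertices at
one common level, on paths `(dᵢ, rᵢ)`, goes to that level of the path `(f(d), f(r))`; which vertex
there is decided by the set of inputs alone. A tuple of mixed levels goes to an entry with minimal
`key`. Edges are preserved (`edge_extend`): if all `Q_l` on the input paths are single edges, then
so is `Q_l` on the output path, because `f` acts component-wise, and edges below the top level are
closed under minima.

The lift depends only on the set of entries and on values of `f` (`extend_congr`). The two sides of
a linear balanced identity involve the same set of entries, so identities are inherited, and so are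
the WNU, cyclic and symmetric properties. Identities `f(x, …, x) = x` need idempotence, which the
rigid core provides.

For weights, the lift takes a value in `R` only if all inputs lie in `R` (`extend_ne_top`). On such
inputs the required inequality is the sum of those for the `ρᵢ`; on all others lifted operations
cost `0`. The lift of a projection need not be a projection, but operations of negative weight must
be. Hence the retained projections, with weight at most `0` and interpreting no symbol, are sent to
projections instead. Their weighted cost is never positive. A projection of positive weight could
violate the inequality on mixed inputs, so it is lifted. -/

namespace WeightedHom

universe u v w

/-! ### Levels of the digraph and the choice of a vertex on a path. -/

namespace Vertex

variable {D : Type u} {n : ℕ} {R : Set (Fin n → D)}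

/-- The path `(d, r)` of an inner vertex, and its distance from the end of the first edge. -/
def coord : Vertex R → Option (D × R × Fin (n + 1))
  | base _ => none
  | top _ => none
  | joint d r m => some (d, r, m)
  | hi d r l _ => some (d, r, l.succ)
  | lo d r l _ => some (d, r, l.castSucc)

/-- The level of a vertex: each edge goes up by one level. -/
def height : Vertex R → ℕ
  | base _ => 0
  | top _ => n + 2
  | joint _ _ m => m + 1
  | hi _ _ l _ => l + 2
  | lo _ _ l _ => l + 1

inductive IsHi : Vertex R → Prop
  | mk (d r l h) : IsHi (hi d r l h)

inductive IsLo : Vertex R → Prop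
  | mk (d r l h) : IsLo (lo d r l h)

/-- The vertex is the initial vertex of a zigzag. -/
inductive IsZigStart : Vertex R → Prop
  | mk (d r) (l : Fin n) (h : d ≠ r.1 l) : IsZigStart (joint d r l.castSucc)

theorem height_of_coord {v : Vertex R} {d : D} {r : R} {m : Fin (n + 1)}
    (h : v.coord = some (d, r, m)) : v.height = m + 1 := by
  cases v <;> simp_all [coord, height] <;> simp [← h.2.2]

theorem height_le (v : Vertex R) : v.height ≤ n + 2 := by
  cases v <;> simp only [height] <;> omega

theorem height_eq_zero {v : Vertex R} : v.height = 0 ↔ ∃ d, v = base d := by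
  cases v <;> simp [height]

theorem height_eq_top {v : Vertex R} : v.height = n + 2 ↔ ∃ r, v = top r := by
  cases v <;> simp [height] <;> omega

theorem exists_coord {v : Vertex R} (h₀ : v.height ≠ 0) (h₁ : v.height ≠ n + 2) :
    ∃ d r m, v.coord = some (d, r, m) := by
  cases v <;> simp_all [height, coord]

open Classical in
/-- The vertex on the path `(d, r)`, at distance `m` from the end of the first edge, that is
chosen for inputs from `s`. -/
noncomputable def pathVertex (d : D) (r : R) (m : Fin (n + 1)) (s : Set (Vertex R)) : Vertex R :=
  if ∃ v ∈ s, IsHi v then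
    if h : ∃ l : Fin n, m = l.succ ∧ d ≠ r.1 l then hi d r h.choose h.choose_spec.2
    else joint d r m
  else if (∃ v ∈ s, IsLo v) ∧ ∀ v ∈ s, ¬ IsZigStart v then
    if h : ∃ l : Fin n, m = l.castSucc ∧ d ≠ r.1 l then lo d r h.choose h.choose_spec.2
    else joint d r m
  else joint d r m

theorem pathVertex_eq_hi {d : D} {r : R} {l : Fin n} {s : Set (Vertex R)} (hs : ∃ v ∈ s, IsHi v)
    (h : d ≠ r.1 l) : pathVertex d r l.succ s = hi d r l h := by
  have H : ∃ l' : Fin n, l.succ = l'.succ ∧ d ≠ r.1 l' := ⟨l, rfl, h⟩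
  have hl : H.choose = l := (Fin.succ_injective _ H.choose_spec.1).symm
  rw [pathVertex, if_pos hs, dif_pos H]
  congr

theorem pathVertex_eq_lo {d : D} {r : R} {l : Fin n} {s : Set (Vertex R)} (hs : ¬ ∃ v ∈ s, IsHi v)
    (hs' : ∃ v ∈ s, IsLo v) (hs'' : ∀ v ∈ s, ¬ IsZigStart v)
    (h : d ≠ r.1 l) : pathVertex d r l.castSucc s = lo d r l h := by
  have H : ∃ l' : Fin n, l.castSucc = l'.castSucc ∧ d ≠ r.1 l' := ⟨l, rfl, h⟩
  have hl : H.choose = l := (Fin.castSucc_injective _ H.choose_spec.1).symm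
  rw [pathVertex, if_neg hs, if_pos ⟨hs', hs''⟩, dif_pos H]
  congr

theorem pathVertex_of_not_hi_of_not_lo {d : D} {r : R} {m : Fin (n + 1)} {s : Set (Vertex R)}
    (hs : ∀ v ∈ s, ¬ IsHi v) (hs' : ∀ v ∈ s, ¬ IsLo v) : pathVertex d r m s = joint d r m := by
  rw [pathVertex, if_neg (by simpa using hs), if_neg]
  rintro ⟨⟨v, hv, hv'⟩, -⟩
  exact hs' v hv hv'

theorem pathVertex_of_zigStart {d : D} {r : R} {m : Fin (n + 1)} {s : Set (Vertex R)}
    (hs : ∀ v ∈ s, ¬ IsHi v) (hs' : ∃ v ∈ s, IsZigStart v) : pathVertex d r m s = joint d r m := by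
  rw [pathVertex, if_neg (by simpa using hs), if_neg]
  rintro ⟨-, h⟩
  obtain ⟨v, hv, hv'⟩ := hs'
  exact h v hv hv'

theorem pathVertex_succ_of_eq {d : D} {r : R} {l : Fin n} {s : Set (Vertex R)}
    (hs : ∀ v ∈ s, ¬ IsLo v) (h : d = r.1 l) : pathVertex d r l.succ s = joint d r l.succ := by
  by_cases hs' : ∃ v ∈ s, IsHi v
  · rw [pathVertex, if_pos hs', dif_neg]
    rintro ⟨l', hl, hl'⟩
    obtain rfl := Fin.succ_injective _ hl
    exact hl' h
  · exact pathVertex_of_not_hi_of_not_lo (by simpa using hs') hs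

theorem pathVertex_castSucc_of_eq {d : D} {r : R} {l : Fin n} {s : Set (Vertex R)}
    (hs : ∀ v ∈ s, ¬ IsHi v) (h : d = r.1 l) :
    pathVertex d r l.castSucc s = joint d r l.castSucc := by
  rw [pathVertex, if_neg (by simpa using hs)]
  split_ifs with h₁ h₂
  · obtain ⟨l', hl, hl'⟩ := h₂
    obtain rfl := Fin.castSucc_injective _ hl
    exact absurd h hl'
  · rfl
  · rfl

theorem pathVertex_ne_top (d : D) (r r' : R) (m : Fin (n + 1)) (s : Set (Vertex R)) :
    pathVertex d r m s ≠ top r' := by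
  unfold pathVertex
  split_ifs <;> simp

theorem pathVertex_singleton {v : Vertex R} {d : D} {r : R} {m : Fin (n + 1)}
    (h : v.coord = some (d, r, m)) : pathVertex d r m {v} = v := by
  cases v with
  | base => simp [coord] at h
  | top => simp [coord] at h
  | joint d r m =>
    simp only [coord, Option.some.injEq, Prod.mk.injEq] at h
    obtain ⟨rfl, rfl, rfl⟩ := h
    apply pathVertex_of_not_hi_of_not_lo <;> rintro v rfl ⟨⟩
  | hi d r l h' =>
    simp only [coord, Option.some.injEq, Prod.mk.injEq] at h
    obtain ⟨rfl, rfl, rfl⟩ := h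
    exact pathVertex_eq_hi ⟨_, Set.mem_singleton _, .mk ..⟩ h'
  | lo d r l h' =>
    simp only [coord, Option.some.injEq, Prod.mk.injEq] at h
    obtain ⟨rfl, rfl, rfl⟩ := h
    refine pathVertex_eq_lo ?_ ⟨_, Set.mem_singleton _, .mk ..⟩ ?_ h'
    · rintro ⟨v, rfl, ⟨⟩⟩
    · rintro v rfl hz
      generalize hw : lo d r l h' = w at hz
      cases hz
      cases hw

variable (eD : D → ℕ) (eR : R → ℕ)

/-- A key whose lexicographic order makes the edge relation closed under minima on each level
below the top. -/
def key : Vertex R → ℕ ×ₗ ℕ ×ₗ ℕ ×ₗ ℕ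
  | base d => toLex (0, toLex (eD d, toLex (0, 0)))
  | top r => toLex (n + 2, toLex (0, toLex (eR r, 0)))
  | joint d r m => toLex (m + 1, toLex (eD d, toLex (eR r, 1)))
  | hi d r l _ => toLex (l + 2, toLex (eD d, toLex (eR r, 0)))
  | lo d r l _ => toLex (l + 1, toLex (eD d, toLex (eR r, 2)))

theorem height_le_of_key_le {v w : Vertex R} (h : key eD eR v ≤ key eD eR w) :
    v.height ≤ w.height := by
  have key_fst : ∀ v : Vertex R, (ofLex (key eD eR v)).1 = v.height := by
    intro v; cases v <;> rfl
  rw [Prod.Lex.le_iff, key_fst, key_fst] at h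
  omega

end Vertex

open Vertex

/-! ### Edges within a path, and closure of edges under minima. -/

section Edges

variable {D : Type u} {n : ℕ} {R : Set (Fin n → D)}

theorem Edge.height_eq {a b : Vertex R} (h : Edge R a b) : b.height = a.height + 1 := by
  cases h <;> simp [height]

/-- Local analysis of one segment `Q_l`: these facts are all that `edge_extend` needs to know about
the input edges. In particular, a source that is neither a zigzag start nor a `lo` vertex forces
`Q_l` to be a single edge. -/
theorem Edge.of_coord {a b : Vertex R} (h : Edge R a b) {d : D} {r : R} {m : Fin (n + 1)}
    (ha : a.coord = some (d, r, m)) :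
    (m = Fin.last n ∧ a = joint d r m ∧ b = top r) ∨
    ∃ l : Fin n, m = l.castSucc ∧ b.coord = some (d, r, l.succ) ∧ ¬ IsHi a ∧ ¬ IsLo b ∧
      (IsZigStart a → IsHi b) ∧ (¬ IsZigStart a → ¬ IsLo a → d = r.1 l) := by
  cases h with
  | first => simp [coord] at ha
  | last d r =>
    simp only [coord, Option.some.injEq, Prod.mk.injEq] at ha
    obtain ⟨rfl, rfl, rfl⟩ := ha
    exact .inl ⟨rfl, rfl, rfl⟩
  | single d r l h =>
    simp only [coord, Option.some.injEq, Prod.mk.injEq] at ha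
    obtain ⟨rfl, rfl, rfl⟩ := ha
    refine .inr ⟨l, rfl, rfl, nofun, nofun, fun hz => ?_, fun _ _ => h⟩
    generalize hw : joint d r l.castSucc = w at hz
    obtain ⟨d', r', l', h'⟩ := hz
    simp only [joint.injEq, Fin.castSucc_inj] at hw
    obtain ⟨rfl, rfl, rfl⟩ := hw
    exact absurd h h'
  | zig₁ d r l h =>
    simp only [coord, Option.some.injEq, Prod.mk.injEq] at ha
    obtain ⟨rfl, rfl, rfl⟩ := ha
    exact .inr ⟨l, rfl, rfl, nofun, nofun, fun _ => .mk .., fun hz => absurd (.mk _ _ _ h) hz⟩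
  | zig₂ d r l h =>
    simp only [coord, Option.some.injEq, Prod.mk.injEq] at ha
    obtain ⟨rfl, rfl, rfl⟩ := ha
    exact .inr ⟨l, rfl, rfl, nofun, nofun, fun _ => .mk .., fun _ hl => absurd (.mk ..) hl⟩
  | zig₃ d r l h =>
    simp only [coord, Option.some.injEq, Prod.mk.injEq] at ha
    obtain ⟨rfl, rfl, rfl⟩ := ha
    refine .inr ⟨l, rfl, rfl, nofun, nofun, fun hz => ?_, fun _ hl => absurd (.mk ..) hl⟩
    generalize hw : lo d r l h = w at hz
    cases hz
    cases hw

/-- On a level, `key` compares paths before positions. Within a zigzag the initial vertex precedes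
`lo`, and `hi` precedes the final vertex, so the only missing edge, from the initial to the final
vertex, is never demanded. The top level is excluded because a vertex of `R` lies on many paths and
its key ignores `d`. -/
theorem Edge.of_key_le {eD : D → ℕ} {eR : R → ℕ} (hD : eD.Injective) (hR : eR.Injective)
    {a b a' b' : Vertex R} (h : Edge R a b) (h' : Edge R a' b')
    (ha : key eD eR a ≤ key eD eR a') (hb : key eD eR b' ≤ key eD eR b)
    (hlt : b'.height ≠ n + 2) : Edge R a b' := by
  have e₁ := height_le_of_key_le _ _ ha
  have e₂ := height_le_of_key_le _ _ hb
  have e₃ := h.height_eq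
  have e₄ := h'.height_eq
  have e : a.height = a'.height := by omega
  clear e₁ e₂ e₃ e₄
  rcases h with ⟨d, r⟩ | ⟨d, r⟩ | ⟨d, r, l, hl⟩ | ⟨d, r, l, hl⟩ | ⟨d, r, l, hl⟩ | ⟨d, r, l, hl⟩ <;>
  rcases h' with
    ⟨d', r'⟩ | ⟨d', r'⟩ | ⟨d', r', l', hl'⟩ | ⟨d', r', l', hl'⟩ | ⟨d', r', l', hl'⟩ | ⟨d', r', l', hl'⟩ <;>
  simp only [height, Fin.val_castSucc, Fin.val_last, Nat.add_right_cancel_iff] at e hlt <;>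
  (try omega) <;>
  simp only [key, Prod.Lex.toLex_le_toLex, Fin.val_castSucc, Fin.val_succ, e] at ha hb
  case first.first =>
    obtain rfl : d = d' := hD (by omega)
    exact .first _ _
  -- The edges lie on the same level, and the two key inequalities bound the path of either edge by
  -- that of the other, so the paths agree. Only the last key component remains to be compared.
  all_goals
    obtain rfl : l = l' := Fin.ext e
    obtain rfl : d = d' := hD (by omega)
    obtain rfl : r = r' := hR (by omega)
    first
    | omega
    | exact absurd hl hl'
    | exact absurd hl' hl
    | exact .single _ _ _ hl
    | exact .zig₁ _ _ _ hl
    | exact .zig₂ _ _ _ hl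
    | exact .zig₃ _ _ _ hl

end Edges

/-! ### The lift of a polymorphism of `R` to the digraph. -/

section Extension

variable {D : Type u} {n : ℕ} {R : Set (Fin n → D)} {k : ℕ}

/-- The action of a polymorphism on the tuples of a relation. -/
def Preserves.onTuples {f : Op k D} (hf : Preserves f R) (r : Fin k → R) : R :=
  ⟨applyTuple f fun i => (r i).1, hf _ fun i => (r i).2⟩

variable [NeZero k] (eD : D → ℕ) (eR : R → ℕ)

theorem exists_key_le (x : Fin k → Vertex R) :
    ∃ v ∈ Set.range x, ∀ w ∈ Set.range x, key eD eR v ≤ key eD eR w :=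
  Set.exists_min_image _ _ (Set.finite_range x) (Set.range_nonempty x)

open Classical in
/-- The extension of a polymorphism of `R` to the vertices of the digraph. -/
noncomputable def extend {f : Op k D} (hf : Preserves f R) : Op k (Vertex R) := fun x =>
  if h : ∃ d : Fin k → D, x = fun i => base (d i) then base (f h.choose)
  else if h : ∃ r : Fin k → R, x = fun i => top (r i) then top (hf.onTuples h.choose)
  else if h : ∃ q : (Fin k → D) × (Fin k → R) × Fin (n + 1),
      ∀ i, (x i).coord = some (q.1 i, q.2.1 i, q.2.2) then
    pathVertex (f h.choose.1) (hf.onTuples h.choose.2.1) h.choose.2.2 (Set.range x)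
  else (exists_key_le eD eR x).choose

variable {f : Op k D} (hf : Preserves f R)

theorem extend_base (d : Fin k → D) : extend eD eR hf (fun i => base (d i)) = base (f d) := by
  have h : ∃ d' : Fin k → D, (fun i => base (d i) : Fin k → Vertex R) = fun i => base (d' i) :=
    ⟨d, rfl⟩
  have hd : h.choose = d := by
    funext i
    simpa using (congrFun h.choose_spec i).symm
  rw [extend, dif_pos h, hd]

theorem extend_top (r : Fin k → R) :
    extend eD eR hf (fun i => top (r i)) = top (hf.onTuples r) := by
  have h : ∃ r' : Fin k → R, (fun i => top (r i) : Fin k → Vertex R) = fun i => top (r' i) :=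
    ⟨r, rfl⟩
  have hd : h.choose = r := by
    funext i
    simpa using (congrFun h.choose_spec i).symm
  rw [extend, dif_neg, dif_pos h, hd]
  rintro ⟨d, hd⟩
  simpa using congrFun hd 0

theorem extend_inner {x : Fin k → Vertex R} {d : Fin k → D} {r : Fin k → R} {m : Fin (n + 1)}
    (hx : ∀ i, (x i).coord = some (d i, r i, m)) :
    extend eD eR hf x = pathVertex (f d) (hf.onTuples r) m (Set.range x) := by
  have h : ∃ q : (Fin k → D) × (Fin k → R) × Fin (n + 1),
      ∀ i, (x i).coord = some (q.1 i, q.2.1 i, q.2.2) := ⟨(d, r, m), hx⟩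
  have hq : h.choose = (d, r, m) := by
    have H := fun i => (hx i).symm.trans (h.choose_spec i)
    simp only [Option.some.injEq, Prod.mk.injEq] at H
    exact Prod.ext (funext fun i => (H i).1.symm)
      (Prod.ext (funext fun i => (H i).2.1.symm) (H 0).2.2.symm)
  rw [extend, dif_neg, dif_neg, dif_pos h, hq]
  · rintro ⟨r', rfl⟩
    simpa [coord] using hx 0
  · rintro ⟨r', rfl⟩
    simpa [coord] using hx 0

theorem extend_of_height_ne {x : Fin k → Vertex R} (hx : ¬ ∃ m, ∀ i, (x i).height = m) :
    extend eD eR hf x = (exists_key_le eD eR x).choose := by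
  rw [extend, dif_neg, dif_neg, dif_neg]
  · rintro ⟨q, hq⟩
    exact hx ⟨_, fun i => height_of_coord (hq i)⟩
  · rintro ⟨r', rfl⟩
    exact hx ⟨_, fun i => rfl⟩
  · rintro ⟨r', rfl⟩
    exact hx ⟨_, fun i => rfl⟩

theorem tuple_cases (x : Fin k → Vertex R) :
    (∃ d : Fin k → D, x = fun i => base (d i)) ∨
    (∃ r : Fin k → R, x = fun i => top (r i)) ∨
    (∃ (d : Fin k → D) (r : Fin k → R) (m : Fin (n + 1)),
      ∀ i, (x i).coord = some (d i, r i, m)) ∨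
    ¬ ∃ m, ∀ i, (x i).height = m := by
  by_cases hx : ∃ m, ∀ i, (x i).height = m
  · obtain ⟨m, hm⟩ := hx
    by_cases h₀ : m = 0
    · subst h₀
      choose d hd using fun i => height_eq_zero.1 (hm i)
      exact .inl ⟨d, funext hd⟩
    by_cases h₁ : m = n + 2
    · subst h₁
      choose d hd using fun i => height_eq_top.1 (hm i)
      exact .inr (.inl ⟨d, funext hd⟩)
    choose d r l hl using fun i => exists_coord (v := x i) (by rwa [hm]) (by rwa [hm])
    refine .inr (.inr (.inl ⟨d, r, l 0, fun i => ?_⟩))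
    rw [hl i]
    have h : l i = l 0 := by
      have := (height_of_coord (hl i)).symm.trans ((hm i).trans (hm 0).symm)
      rw [height_of_coord (hl 0)] at this
      exact Fin.ext (by omega)
    rw [h]
  · exact .inr (.inr (.inr hx))

/-- For mixed levels, a minimal key at the top level would force every entry up to that level. This
controls the cost, and keeps `Edge.of_key_le` away from its excluded level. -/
theorem extend_ne_top {x : Fin k → Vertex R} (hx : ¬ ∃ r : Fin k → R, x = fun i => top (r i))
    (r : R) : extend eD eR hf x ≠ top r := by
  obtain ⟨d, rfl⟩ | h | ⟨d, r, m, h⟩ | h := tuple_cases x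
  · simp [extend_base]
  · exact absurd h hx
  · rw [extend_inner eD eR hf h]
    exact pathVertex_ne_top _ _ _ _ _
  · rw [extend_of_height_ne eD eR hf h]
    intro h'
    obtain ⟨-, H⟩ := (exists_key_le eD eR x).choose_spec
    rw [h'] at H
    refine h ⟨n + 2, fun i => le_antisymm (height_le _) ?_⟩
    exact height_le_of_key_le eD eR (H _ ⟨i, rfl⟩)

/-- Every value of `f` and `g` used by the lifts is taken at a `D`-valued function of the entries:
the base point `d` or a component of `r`. Quantifying over all maps `p` covers these at once. -/
theorem extend_congr {g : Op k D} (hg : Preserves g R) {x y : Fin k → Vertex R}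
    (hxy : Set.range x = Set.range y)
    (h : ∀ p : Vertex R → D, f (fun i => p (x i)) = g fun i => p (y i)) :
    extend eD eR hf x = extend eD eR hg y := by
  have hy : ∀ i, ∃ j, x j = y i := fun i => by
    have : y i ∈ Set.range x := hxy ▸ ⟨i, rfl⟩
    exact this
  choose σ hσ using hy
  obtain rfl : (fun i => x (σ i)) = y := funext hσ
  obtain ⟨d, rfl⟩ | ⟨r, rfl⟩ | ⟨d, r, m, hx⟩ | hx := tuple_cases x
  · rw [extend_base, extend_base eD eR hg fun i => d (σ i)]
    congr 1
    -- The default value is irrelevant: every entry is a base vertex.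
    exact h fun | base d => d | _ => d 0
  · rw [extend_top, extend_top eD eR hg fun i => r (σ i)]
    congr 1
    exact Subtype.ext (funext fun l => h fun | top r => r.1 l | _ => (r 0).1 l)
  · rw [extend_inner eD eR hf hx, extend_inner eD eR hg fun i => hx (σ i), hxy]
    have h₁ : f d = g fun i => d (σ i) := by
      simpa [hx] using h fun v => (v.coord.map (·.1)).getD (d 0)
    have h₂ : hf.onTuples r = hg.onTuples fun i => r (σ i) := by
      refine Subtype.ext (funext fun l => ?_)
      change (f fun i => (r i).1 l) = g fun i => (r (σ i)).1 l
      simpa [hx] using h fun v => (v.coord.map (·.2.1.1 l)).getD (d 0)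
    rw [h₁, h₂]
  · rw [extend_of_height_ne eD eR hf hx, extend_of_height_ne eD eR hg]
    -- The minimal vertex is chosen from a predicate on the range alone, so ties are broken
    -- identically for equal ranges.
    · congr 1
      rw [hxy]
    · rintro ⟨m, hm⟩
      refine hx ⟨m, fun i => ?_⟩
      obtain ⟨j, hj⟩ : x i ∈ Set.range fun i => x (σ i) := hxy ▸ ⟨i, rfl⟩
      rw [← hj]
      exact hm j

theorem extend_const (hid : ∀ d, f (fun _ => d) = d) (v : Vertex R) :
    extend eD eR hf (fun _ => v) = v := by
  have hr : ∀ r : R, hf.onTuples (fun _ => r) = r := fun r =>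
    Subtype.ext (funext fun l => hid _)
  obtain ⟨d, h⟩ | ⟨r, h⟩ | ⟨d, r, m, h⟩ | h := tuple_cases fun _ : Fin k => v
  · obtain rfl := congrFun h 0
    rw [extend_base eD eR hf fun _ => d 0, hid]
  · obtain rfl := congrFun h 0
    rw [extend_top eD eR hf fun _ => r 0, hr]
  · rw [extend_inner eD eR hf (d := fun _ => d 0) (r := fun _ => r 0) fun i => h 0, hid, hr,
      Set.range_const]
    exact pathVertex_singleton (h 0)
  · exact absurd ⟨_, fun _ => rfl⟩ h

theorem edge_extend (heD : eD.Injective) (heR : eR.Injective) {x y : Fin k → Vertex R}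
    (hxy : ∀ i, Edge R (x i) (y i)) :
    Edge R (extend eD eR hf x) (extend eD eR hf y) := by
  obtain ⟨d, rfl⟩ | ⟨r, rfl⟩ | ⟨d, r, m, hx⟩ | hx := tuple_cases x
  · have H : ∀ i, ∃ r, y i = joint (d i) r 0 := fun i => by
      generalize hy : y i = b
      have := hxy i
      rw [hy] at this
      cases this
      exact ⟨_, rfl⟩
    choose r hr using H
    obtain rfl : y = _ := funext hr
    rw [extend_base, extend_inner eD eR hf (d := d) (r := r) (m := 0) fun _ => rfl,
      pathVertex_of_not_hi_of_not_lo]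
    · exact .first _ _
    · rintro _ ⟨i, rfl⟩ ⟨⟩
    · rintro _ ⟨i, rfl⟩ ⟨⟩
  · nomatch hxy 0
  · have H := fun i => (hxy i).of_coord (hx i)
    obtain ⟨rfl, -⟩ | ⟨l, rfl, -⟩ := H 0
    -- A `hi` vertex may also lie on this level, but it has no outgoing edge; hence all entries of
    -- `x` are joints.
    · have H' : ∀ i, x i = joint (d i) (r i) (Fin.last n) ∧ y i = top (r i) := fun i =>
        (H i).elim And.right fun ⟨l, hl, _⟩ => absurd hl.symm (Fin.castSucc_lt_last l).ne
      obtain rfl : x = _ := funext fun i => (H' i).1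
      obtain rfl : y = _ := funext fun i => (H' i).2
      rw [extend_top, extend_inner eD eR hf hx, pathVertex_of_not_hi_of_not_lo]
      · exact .last _ _
      · rintro _ ⟨i, rfl⟩ ⟨⟩
      · rintro _ ⟨i, rfl⟩ ⟨⟩
    · have H' : ∀ i, (y i).coord = some (d i, r i, l.succ) ∧ ¬ IsHi (x i) ∧ ¬ IsLo (y i) ∧
          (IsZigStart (x i) → IsHi (y i)) ∧
          (¬ IsZigStart (x i) → ¬ IsLo (x i) → d i = (r i).1 l) := fun i => by
        obtain ⟨h, -⟩ | ⟨l', hl, h⟩ := H i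
        · exact absurd h (Fin.castSucc_lt_last l).ne
        · rwa [Fin.castSucc_injective _ hl]
      have hxhi : ∀ v ∈ Set.range x, ¬ IsHi v := by
        rintro _ ⟨i, rfl⟩
        exact (H' i).2.1
      have hylo : ∀ v ∈ Set.range y, ¬ IsLo v := by
        rintro _ ⟨i, rfl⟩
        exact (H' i).2.2.1
      rw [extend_inner eD eR hf hx, extend_inner eD eR hf fun i => (H' i).1]
      by_cases hfl : f d = (hf.onTuples r).1 l
      · rw [pathVertex_castSucc_of_eq hxhi hfl, pathVertex_succ_of_eq hylo hfl]
        exact .single _ _ _ hfl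
      -- The output segment is a zigzag. If `x` contains a zigzag start, then `y` contains a `hi`
      -- vertex, and the outputs are the initial vertex and `hi`. Otherwise the first output is
      -- `lo`, which is adjacent to both possible second outputs.
      · by_cases hz : ∃ v ∈ Set.range x, IsZigStart v
        · rw [pathVertex_of_zigStart hxhi hz, pathVertex_eq_hi _ hfl]
          · exact .zig₁ _ _ _ hfl
          · obtain ⟨_, ⟨i, rfl⟩, hi⟩ := hz
            exact ⟨_, ⟨i, rfl⟩, (H' i).2.2.2.1 hi⟩
        · have hz' : ∀ v ∈ Set.range x, ¬ IsZigStart v := fun v hv hv' => hz ⟨v, hv, hv'⟩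
          rw [pathVertex_eq_lo (by simpa using hxhi) _ hz' hfl]
          · by_cases hhi : ∃ v ∈ Set.range y, IsHi v
            · rw [pathVertex_eq_hi hhi hfl]
              exact .zig₂ _ _ _ hfl
            · rw [pathVertex_of_not_hi_of_not_lo (by simpa using hhi) hylo]
              exact .zig₃ _ _ _ hfl
          -- With neither a zigzag start nor a `lo` vertex in `x`, every input segment is a single
          -- edge, so `f` gives `f d = f(r)_l`, against `hfl`.
          · by_contra hlo
            refine hfl (congrArg f (funext fun i => ?_))
            exact (H' i).2.2.2.2 (hz' _ ⟨i, rfl⟩) fun h => hlo ⟨_, ⟨i, rfl⟩, h⟩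
  · have hy : ¬ ∃ m, ∀ i, (y i).height = m := by
      rintro ⟨m, hm⟩
      refine hx ⟨m - 1, fun i => ?_⟩
      have := (hxy i).height_eq
      rw [hm] at this
      omega
    have hne := extend_ne_top eD eR hf (x := y) (by
      rintro ⟨r, rfl⟩
      exact hy ⟨_, fun _ => rfl⟩)
    rw [extend_of_height_ne eD eR hf hx]
    rw [extend_of_height_ne eD eR hf hy] at hne ⊢
    obtain ⟨⟨i, hi⟩, hmx⟩ := (exists_key_le eD eR x).choose_spec
    obtain ⟨⟨j, hj⟩, hmy⟩ := (exists_key_le eD eR y).choose_spec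
    rw [← hi] at hmx ⊢
    rw [← hj] at hmy hne ⊢
    -- The minima of `x` and `y` may occur at different indices `i` and `j`; minimality supplies the
    -- crossed inequalities joining `x i` to `y j`.
    refine (hxy i).of_key_le heD heR (hxy j) (hmx _ ⟨j, rfl⟩) (hmy _ ⟨i, rfl⟩) fun h => ?_
    obtain ⟨r, hr⟩ := height_eq_top.1 h
    exact hne r hr

theorem isWNU_extend (h : IsWNU f) : IsWNU (extend eD eR hf) := by
  refine ⟨h.1, extend_const eD eR hf h.2.1, fun x y i j => ?_⟩
  have hrange : ∀ i : Fin k, Set.range (Function.update (fun _ => x) i y) = {x, y} := fun i => by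
    -- A second index ensures that `x` itself occurs among the entries.
    have : Nontrivial (Fin k) := Fin.nontrivial_iff_two_le.2 h.1
    obtain ⟨j, hj⟩ := exists_ne i
    ext v
    constructor
    · rintro ⟨l, rfl⟩
      by_cases hl : l = i
      · simp [hl]
      · simp [hl]
    · rintro (rfl | rfl)
      · exact ⟨j, by simp [hj]⟩
      · exact ⟨i, by simp⟩
  refine extend_congr eD eR hf hf ((hrange i).trans (hrange j).symm) fun p => ?_
  have := h.2.2 (p x) (p y) i j
  have key : ∀ i : Fin k, (fun l => p (Function.update (fun _ => x) i y l)) =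
      Function.update (fun _ => p x) i (p y) := fun i => by
    funext l
    by_cases hl : l = i
    · subst hl; simp
    · simp [hl]
  rw [key, key, this]

theorem isCyclic_extend (h : IsCyclic f) : IsCyclic (extend eD eR hf) :=
  ⟨h.1, fun x => extend_congr eD eR hf hf ((finRotate k).surjective.range_comp x).symm
    fun p => h.2 fun i => p (x i)⟩

theorem isSymmetric_extend (h : IsSymmetric f) : IsSymmetric (extend eD eR hf) :=
  ⟨h.1, fun x π => extend_congr eD eR hf hf (π.surjective.range_comp x).symm
    fun p => h.2 (fun i => p (x i)) π⟩

end Extension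

/-! ### Projections against WNU, cyclic and symmetric operations. -/

section Projections

variable {A : Type u} {k : ℕ}

theorem IsProjection.not_isSymmetric [Nontrivial A] {f : Op k A} (hf : IsProjection f) :
    ¬ IsSymmetric f := by
  rintro ⟨hk, h⟩
  obtain ⟨i, hi⟩ := hf
  obtain ⟨a, b, hab⟩ := exists_pair_ne A
  have : Nontrivial (Fin k) := Fin.nontrivial_iff_two_le.2 hk
  obtain ⟨j, hj⟩ := exists_ne i
  have := h (Function.update (fun _ => a) i b) (Equiv.swap i j)
  simp [hi, hj] at this
  exact hab this.symm

theorem IsProjection.not_isCyclic [Nontrivial A] {f : Op k A} (hf : IsProjection f) :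
    ¬ IsCyclic f := by
  rintro ⟨hk, h⟩
  obtain ⟨i, hi⟩ := hf
  obtain ⟨a, b, hab⟩ := exists_pair_ne A
  have hj : finRotate k i ≠ i := by
    obtain ⟨k, rfl⟩ := Nat.exists_eq_add_of_le' hk
    simp
  have := h (Function.update (fun _ => a) i b)
  rw [hi, hi, Function.update_self, Function.update_of_ne hj] at this
  exact hab this.symm

theorem IsProjection.not_isWNU [Nontrivial A] {f : Op k A} (hf : IsProjection f) :
    ¬ IsWNU f := by
  rintro ⟨hk, -, h⟩
  obtain ⟨i, hi⟩ := hf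
  obtain ⟨a, b, hab⟩ := exists_pair_ne A
  have : Nontrivial (Fin k) := Fin.nontrivial_iff_two_le.2 hk
  obtain ⟨j, hj⟩ := exists_ne i
  have := h a b i j
  simp [hi, hj.symm] at this
  exact hab this.symm

theorem isWNU_of_subsingleton [Subsingleton A] (hk : 2 ≤ k) (f : Op k A) : IsWNU f :=
  ⟨hk, fun _ => Subsingleton.elim _ _, fun _ _ _ _ => Subsingleton.elim _ _⟩

theorem isCyclic_of_subsingleton [Subsingleton A] (hk : 2 ≤ k) (f : Op k A) : IsCyclic f :=
  ⟨hk, fun _ => Subsingleton.elim _ _⟩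

theorem isSymmetric_of_subsingleton [Subsingleton A] (hk : 2 ≤ k) (f : Op k A) :
    IsSymmetric f :=
  ⟨hk, fun _ _ => Subsingleton.elim _ _⟩

theorem isProjection_of_unary {f : Op 1 A} (hf : ∀ a, f (fun _ => a) = a) : IsProjection f :=
  ⟨0, fun x => by
    rw [← hf (x 0)]
    congr 1
    funext i
    rw [Subsingleton.elim i 0]⟩

end Projections

/-! ### Linear terms and the transfer of identities. -/

section Terms

variable {L : Type v} {k : ℕ} {X : Type w}

theorem OpTerm.eq_var_of_opCount_eq_zero {t : OpTerm L k X} (h : t.opCount = 0) :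
    ∃ x, t = var x := by
  cases t with
  | var x => exact ⟨x, rfl⟩
  | app s args => simp [opCount] at h

theorem OpTerm.cases_of_opCount_le_one {t : OpTerm L k X} (h : t.opCount ≤ 1) :
    (∃ x, t = var x) ∨ ∃ s, ∃ τ : Fin k → X, t = app s fun i => var (τ i) := by
  cases t with
  | var x => exact .inl ⟨x, rfl⟩
  | app s args =>
    have h0 : ∑ i, (args i).opCount = 0 := by
      simp only [opCount] at h
      omega
    rw [Finset.sum_eq_zero_iff] at h0
    choose τ hτ using fun i => eq_var_of_opCount_eq_zero (h0 i (Finset.mem_univ i))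
    exact .inr ⟨s, τ, congrArg _ (funext hτ)⟩

end Terms

/-- Balancedness makes the ranges of the two argument tuples equal, and applying the original
identity to the assignments `p ∘ a` gives the other hypothesis of `extend_congr`. If one side is a
variable, the argument tuple on the other side is constant and idempotence applies. -/
theorem satisfies_extend {D : Type u} {n : ℕ} {R : Set (Fin n → D)} {k : ℕ} [NeZero k]
    (eD : D → ℕ) (eR : R → ℕ) {L : Type v} {X : Type w} {I : L → Op k D}
    (hI : ∀ s, Preserves (I s) R) (hid : ∀ s d, I s (fun _ => d) = d)
    {Sigma : Set (Identity L k X)} (hlin : ∀ e ∈ Sigma, e.IsLinear)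
    (hbal : ∀ e ∈ Sigma, e.IsBalanced) (hsat : Satisfies I Sigma) :
    Satisfies (fun s => extend eD eR (hI s)) Sigma := by
  intro e he a
  have H := hsat e he
  have hb : e.lhs.vars = e.rhs.vars := hbal e he
  obtain ⟨t₁, t₂⟩ := e
  have hconst : ∀ (τ : Fin k → X) x, Set.range τ = {x} → (fun i => a (τ i)) = fun _ => a x :=
    fun τ x h => funext fun i => congrArg a (h ▸ ⟨i, rfl⟩ : τ i ∈ ({x} : Set X))
  obtain ⟨x, h₁⟩ | ⟨s, τ, h₁⟩ := OpTerm.cases_of_opCount_le_one (hlin _ he).1 <;>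
  obtain ⟨x', h₂⟩ | ⟨s', τ', h₂⟩ := OpTerm.cases_of_opCount_le_one (hlin _ he).2 <;>
  simp only at h₁ h₂ <;> subst h₁ h₂ <;>
  simp only [OpTerm.vars, OpTerm.eval, Set.iUnion_singleton_eq_range] at hb H ⊢
  · rw [Set.singleton_eq_singleton_iff.1 hb]
  · rw [hconst τ' x hb.symm, extend_const eD eR _ (hid s')]
  · rw [hconst τ x' hb, extend_const eD eR _ (hid s)]
  · refine extend_congr eD eR _ _ ?_ fun p => H fun x => p (a x)
    change Set.range (a ∘ τ) = Set.range (a ∘ τ')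
    rw [Set.range_comp, Set.range_comp, hb]

/-! ### Assignment of digraph operations to `C`, and the weight inequality. -/

section Main

variable {D : Type u} {k : ℕ}

theorem IsPolymorphism.preserves_product {S : WeightedStructure D} {f : Op k D}
    (hf : IsPolymorphism S f) : Preserves f S.product.rel :=
  fun x hx i => hf i (fun a j => x a (finSigmaFinEquiv ⟨i, j⟩)) fun a => hx a i

/-- The diagonal `x ↦ f(x, …, x)` is a unary polymorphism. -/
theorem IsRigidCore.idempotent {S : WeightedStructure D} (hS : IsRigidCore S) {f : Op k D}
    (hf : IsPolymorphism S f) (d : D) : f (fun _ => d) = d :=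
  hS (fun x => f fun _ => x 0) (fun i x hx => hf i (fun _ => x 0) fun _ => hx 0) fun _ => d

theorem sum_product_wt_le_zero {S : WeightedStructure D} {C : Finset (Op k D)} {ω : C → ℚ}
    (hω : IsWeightedPolymorphism S C ω) (r : Fin k → S.product.rel) :
    ∑ f : C, ω f * (S.product.wt ((hω.pol f).preserves_product.onTuples r) : ℚ) ≤ 0 := by
  have h : ∀ f : C, ω f * (S.product.wt ((hω.pol f).preserves_product.onTuples r) : ℚ) =
      ∑ i, ω f * ((S.wrel i).wt ⟨_, hω.pol f i
        (fun a j => (r a).1 (finSigmaFinEquiv ⟨i, j⟩)) fun a => (r a).2 i⟩ : ℚ) := fun f => by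
    rw [← Finset.mul_sum]
    exact congrArg _ (NNRat.cast_sum _ _)
  simp only [h]
  rw [Finset.sum_comm]
  exact Finset.sum_nonpos fun i _ => hω.sum_le_zero i _ fun a => (r a).2 i

/-- The projections that are sent to projections of the digraph. -/
def IsRetained {C : Finset (Op k D)} (ω : C → ℚ) {L : Type v} (I : L → C) (f : C) : Prop :=
  Nontrivial D ∧ IsProjection f.1 ∧ ω f ≤ 0 ∧ f ∉ Set.range I

theorem isRetained_of_neg {S : WeightedStructure D} {C : Finset (Op k D)} {ω : C → ℚ}
    (hω : IsWeightedPolymorphism S C ω) {L : Type v} {I : L → C} (hI : ∀ s, 0 ≤ ω (I s))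
    {f : C} (hf : ω f < 0) : IsRetained ω I f := by
  refine ⟨?_, hω.proj_of_neg f hf, hf.le, ?_⟩
  -- Over a domain with at most one element there is only one operation, so its weight is the whole
  -- sum, which is `0`.
  · by_contra hD
    rw [not_nontrivial_iff_subsingleton] at hD
    have := hω.sum_eq_zero
    rw [Fintype.sum_subsingleton _ f] at this
    exact hf.ne this
  · rintro ⟨s, rfl⟩
    exact (hI s).not_gt hf

variable {S : WeightedStructure D} {C : Finset (Op k D)} {ω : C → ℚ}
  (hω : IsWeightedPolymorphism S C ω) {L : Type v} (I : L → C) [NeZero k]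
  (eD : D → ℕ) (eR : S.product.rel → ℕ)

open Classical in
/-- The operation on the vertices of the digraph assigned to a polymorphism in `C`. -/
noncomputable def digraphOp (f : C) : Op k S.DVertex :=
  if h : IsRetained ω I f then fun x => x h.2.1.choose
  else extend eD eR (hω.pol f).preserves_product

theorem digraphOp_of_not_isRetained {f : C} (h : ¬ IsRetained ω I f) :
    digraphOp hω I eD eR f = extend eD eR (hω.pol f).preserves_product :=
  dif_neg h

theorem digraphOp_of_isRetained {f : C} (h : IsRetained ω I f) :
    ∃ i, (∀ x, f.1 x = x i) ∧ ∀ x, digraphOp hω I eD eR f x = x i :=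
  ⟨_, h.2.1.choose_spec, fun x => congrFun (dif_pos h) x⟩

theorem digraphOp_base (f : C) (d : Fin k → D) :
    digraphOp hω I eD eR f (fun i => .base (d i)) = .base (f.1 d) := by
  by_cases h : IsRetained ω I f
  · obtain ⟨i, hi, hi'⟩ := digraphOp_of_isRetained hω I eD eR h
    rw [hi, hi']
  · rw [digraphOp_of_not_isRetained hω I eD eR h, extend_base]

theorem digraphOp_top (f : C) (r : Fin k → S.product.rel) :
    digraphOp hω I eD eR f (fun i => .top (r i)) =
      .top ((hω.pol f).preserves_product.onTuples r) := by
  by_cases h : IsRetained ω I f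
  · obtain ⟨i, hi, hi'⟩ := digraphOp_of_isRetained hω I eD eR h
    rw [hi']
    exact congrArg _ (Subtype.ext (funext fun l => (hi fun a => (r a).1 l).symm))
  · rw [digraphOp_of_not_isRetained hω I eD eR h, extend_top]

/-- Retained or lifted, the operation restricts to `f` on the base vertices. -/
theorem digraphOp_injective : (digraphOp hω I eD eR).Injective := fun f g h => by
  refine Subtype.ext (funext fun d => ?_)
  have := congrFun h fun i => .base (d i)
  rwa [digraphOp_base, digraphOp_base, Vertex.base.injEq] at this

theorem edge_digraphOp (heD : eD.Injective) (heR : eR.Injective) (f : C)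
    {x y : Fin k → S.DVertex} (hxy : ∀ i, Edge S.product.rel (x i) (y i)) :
    Edge S.product.rel (digraphOp hω I eD eR f x) (digraphOp hω I eD eR f y) := by
  by_cases h : IsRetained ω I f
  · obtain ⟨i, hi, hi'⟩ := digraphOp_of_isRetained hω I eD eR h
    rw [hi', hi']
    exact hxy i
  · rw [digraphOp_of_not_isRetained hω I eD eR h]
    exact edge_extend eD eR _ heD heR hxy

theorem isPolymorphism_digraphOp (heD : eD.Injective) (heR : eR.Injective) (f : C) :
    IsPolymorphism S.toDigraph (digraphOp hω I eD eR f) := by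
  intro (i : Fin 2)
  match i with
  | 0 => exact fun x hx => edge_digraphOp hω I eD eR heD heR f hx
  | 1 => exact fun _ _ => Set.mem_univ _

/-- Away from all-top inputs every summand is non-positive by itself: retained projections have
weight at most `0`, and lifted operations avoid the top, where alone the cost can be nonzero. -/
theorem sum_vertexCost_digraphOp_le_zero (x : Fin k → S.DVertex) :
    ∑ f : C, ω f * (vertexCost S.product (digraphOp hω I eD eR f x) : ℚ) ≤ 0 := by
  by_cases hx : ∃ r : Fin k → S.product.rel, x = fun i => .top (r i)
  · obtain ⟨r, rfl⟩ := hx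
    simp only [digraphOp_top]
    exact sum_product_wt_le_zero hω r
  · refine Finset.sum_nonpos fun f _ => ?_
    by_cases h : IsRetained ω I f
    · exact mul_nonpos_of_nonpos_of_nonneg h.2.2.1 (NNRat.cast_nonneg _)
    · have H := extend_ne_top eD eR (hω.pol f).preserves_product hx
      rw [digraphOp_of_not_isRetained hω I eD eR h]
      generalize extend eD eR (hω.pol f).preserves_product x = v at H
      cases v with
      | top r => exact absurd rfl (H r)
      | _ => simp [vertexCost]

end Main

end WeightedHom

theorem theorem3p10 {D : Type*} [Finite D] (wA : WeightedHom.WeightedStructure D)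
    (hcore : WeightedHom.IsRigidCore wA)
    {k : ℕ} (hk : 1 ≤ k) (C : Finset (WeightedHom.Op k D)) (ω : C → ℚ)
    (hω : WeightedHom.IsWeightedPolymorphism wA C ω)
    {L X : Type*} (Sigma : Set (WeightedHom.Identity L k X))
    (hlin : ∀ e ∈ Sigma, e.IsLinear) (hbal : ∀ e ∈ Sigma, e.IsBalanced)
    (I : L → C) (hI : ∀ s, 0 ≤ ω (I s))
    (hsat : WeightedHom.Satisfies (fun s => (I s).1) Sigma) :
    ∃ (C₀ : Finset (WeightedHom.Op k wA.DVertex)) (ω₀ : C₀ → ℚ) (φ : C ≃ C₀),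
      WeightedHom.IsWeightedPolymorphism wA.toDigraph C₀ ω₀ ∧
      (∀ f, ω₀ (φ f) = ω f) ∧
      WeightedHom.Satisfies (fun s => (φ (I s)).1) Sigma ∧
      (∀ f : C, WeightedHom.IsWNU f.1 → WeightedHom.IsWNU (φ f).1) ∧
      (∀ f : C, WeightedHom.IsCyclic f.1 → WeightedHom.IsCyclic (φ f).1) ∧
      (∀ f : C, WeightedHom.IsSymmetric f.1 → WeightedHom.IsSymmetric (φ f).1) ∧
      ((∀ f : C, WeightedHom.IsProjection f.1 → ω f ≤ 0 ∧ f ∉ Set.range I) →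
        ((∀ f : C, ¬ WeightedHom.IsProjection f.1 → WeightedHom.IsWNU f.1) →
          ∀ g : C₀, ¬ WeightedHom.IsProjection g.1 → WeightedHom.IsWNU g.1) ∧
        ((∀ f : C, ¬ WeightedHom.IsProjection f.1 → WeightedHom.IsCyclic f.1) →
          ∀ g : C₀, ¬ WeightedHom.IsProjection g.1 → WeightedHom.IsCyclic g.1) ∧
        ((∀ f : C, ¬ WeightedHom.IsProjection f.1 → WeightedHom.IsSymmetric f.1) →
          ∀ g : C₀, ¬ WeightedHom.IsProjection g.1 → WeightedHom.IsSymmetric g.1)) := by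
  classical
  have : NeZero k := ⟨by omega⟩
  obtain ⟨eD, heD⟩ := Countable.exists_injective_nat D
  obtain ⟨eR, heR⟩ := Countable.exists_injective_nat wA.product.rel
  set F := WeightedHom.digraphOp hω I eD eR with hF
  have hinj : F.Injective := WeightedHom.digraphOp_injective hω I eD eR
  have hex := fun {f} => WeightedHom.digraphOp_of_not_isRetained (f := f) hω I eD eR
  have hproj : ∀ f, WeightedHom.IsRetained ω I f → WeightedHom.IsProjection (F f) := fun f h =>
    (WeightedHom.digraphOp_of_isRetained hω I eD eR h).imp fun _ h => h.2
  have hI' : ∀ s, ¬ WeightedHom.IsRetained ω I (I s) := fun s h => h.2.2.2 ⟨s, rfl⟩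
  let φ : C ≃ Finset.univ.image F := Equiv.ofBijective
    (fun f => ⟨F f, Finset.mem_image_of_mem _ (Finset.mem_univ f)⟩)
    ⟨fun f g h => hinj (congrArg Subtype.val h), fun ⟨g, hg⟩ => by
      obtain ⟨f, -, rfl⟩ := Finset.mem_image.1 hg
      exact ⟨f, rfl⟩⟩
  have hsymm : ∀ f, φ.symm (φ f) = f := φ.symm_apply_apply
  have hsum : ∀ G : C → ℚ, ∑ g, G (φ.symm g) = ∑ f, G f := fun G => φ.symm.sum_comp G
  -- Retained operations are projections over a nontrivial domain, hence not WNU, so `f` is lifted;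
  -- the cyclic and symmetric cases are alike.
  have hwnu : ∀ f : C, WeightedHom.IsWNU f.1 → WeightedHom.IsWNU (F f) := fun f h => by
    rw [hF, hex fun ⟨_, hp, _⟩ => hp.not_isWNU h]
    exact WeightedHom.isWNU_extend _ _ _ h
  have hcyc : ∀ f : C, WeightedHom.IsCyclic f.1 → WeightedHom.IsCyclic (F f) := fun f h => by
    rw [hF, hex fun ⟨_, hp, _⟩ => hp.not_isCyclic h]
    exact WeightedHom.isCyclic_extend _ _ _ h
  have hsym : ∀ f : C, WeightedHom.IsSymmetric f.1 → WeightedHom.IsSymmetric (F f) :=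
    fun f h => by
      rw [hF, hex fun ⟨_, hp, _⟩ => hp.not_isSymmetric h]
      exact WeightedHom.isSymmetric_extend _ _ _ h
  have hlast : (∀ f : C, WeightedHom.IsProjection f.1 → ω f ≤ 0 ∧ f ∉ Set.range I) →
      ∀ (P : WeightedHom.Op k D → Prop) (Q : WeightedHom.Op k wA.DVertex → Prop),
      (∀ f : C, P f.1 → Q (F f)) → (Subsingleton D → 2 ≤ k → ∀ f, P f) →
      (∀ f : C, ¬ WeightedHom.IsProjection f.1 → P f.1) →
      ∀ g : Finset.univ.image F, ¬ WeightedHom.IsProjection g.1 → Q g.1 := by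
    intro H P Q hPQ hP hC g hg
    obtain ⟨f, rfl⟩ := φ.surjective g
    change ¬ WeightedHom.IsProjection (F f) at hg
    refine hPQ f ?_
    by_cases hf : WeightedHom.IsProjection f.1
    -- Over a nontrivial domain `H` makes the projection `f` retained, so its image would be a
    -- projection. Over a trivial one `f` is lifted: `P` is automatic for `k ≥ 2`, and for `k = 1`
    -- the lift is idempotent and unary, hence a projection.
    · rcases subsingleton_or_nontrivial D with hD | hD
      · refine hP hD ?_ _
        by_contra hk2
        obtain rfl : k = 1 := by omega
        refine hg (WeightedHom.isProjection_of_unary fun v => ?_)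
        rw [hF, hex fun h => not_nontrivial D h.1]
        exact WeightedHom.extend_const _ _ _ (hcore.idempotent (hω.pol f)) v
      · exact absurd (hproj f ⟨hD, hf, H f hf⟩) hg
    · exact hC f hf
  refine ⟨_, fun g => ω (φ.symm g), φ, ⟨?_, ?_, ?_, ?_⟩, fun f => congrArg ω (hsymm f), ?_, hwnu, hcyc,
    hsym, fun H => ⟨hlast H _ _ hwnu fun _ => WeightedHom.isWNU_of_subsingleton,
      hlast H _ _ hcyc fun _ => WeightedHom.isCyclic_of_subsingleton,
      hlast H _ _ hsym fun _ => WeightedHom.isSymmetric_of_subsingleton⟩⟩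
  · intro g
    obtain ⟨f, rfl⟩ := φ.surjective g
    exact WeightedHom.isPolymorphism_digraphOp hω I eD eR heD heR f
  · exact (hsum ω).trans hω.sum_eq_zero
  · intro g hg
    obtain ⟨f, rfl⟩ := φ.surjective g
    rw [hsymm] at hg
    exact hproj f (WeightedHom.isRetained_of_neg hω hI hg)
  · intro (i : Fin 2) x hx
    match i with
    | 0 =>
      refine Finset.sum_nonpos fun g _ => le_of_eq ?_
      exact mul_eq_zero_of_right _ NNRat.cast_zero
    | 1 =>
      refine le_of_eq_of_le ?_
        (WeightedHom.sum_vertexCost_digraphOp_le_zero hω I eD eR fun j => x j (0 : Fin 1))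
      rw [← φ.sum_comp]
      refine Finset.sum_congr rfl fun f _ => ?_
      rw [hsymm]
      rfl
  · have h : (fun s => (φ (I s)).1) = fun s =>
        WeightedHom.extend eD eR (hω.pol (I s)).preserves_product :=
      funext fun s => hex (hI' s)
    rw [h]
    exact WeightedHom.satisfies_extend eD eR _ (fun s => hcore.idempotent (hω.pol (I s)))
      hlin hbal hsat
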